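/- Let $G=(V,E)$ be a finite simple graph. A family $\mathcal A=(A_v)_{v\in V}$ of Hermitian operators on $\mathbb C^d$ ($d\ge 1$) with $A_v^2=\mathbb 1$ has anti-commutativity graph $G$ if $\{v,w\}\in E \iff A_vA_w=-A_wA_v$, and $A_vA_w=A_wA_v$ for all non-adjacent $v,w$. For $\eta\in[0,1]$ let $A_v^\eta=\eta A_v+\frac{\operatorname{tr}A_v}{d}(1-\eta)\mathbb 1$ and $\mathsf M_v^\eta(\pm)=\frac12(\mathbb 1\pm A_v^\eta)$. The family $\mathcal A^\eta=(A_v^\eta)_{v\in V}$ is jointly measurable if there are positive semidefinite operators $\mathsf E(a)$, $a\in\{\pm1\}^V$, with $\sum_a\mathsf E(a)=\mathbb 1$ and $\sum_{a:\,a_v=s}\mathsf E(a)=\mathsf M_v^\eta(s)$ for all $v\in V$, $s=\pm1$. The incompatibility robustness of $G$ is $\eta(G)=\max\{\eta\in[0,1] : \mathcal A^\eta \text{ is jointly measurable}\}$, where $\mathcal A$ is any family with anti-commutativity graph $G$. Let $C_n$, $n\ge 3$, be the cycle graph with $n$ vertices. Then there are families of observables with anti-commutativity graph $C_n$, the maximum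 exists and is the same for every such family in every dimension $d\ge1$, and $$\eta(C_n)=\begin{cases}\frac1n\cot\!\left(\frac{\pi}{2n}\right), & n\text{ odd},\\[2pt] \frac2n\csc\!\left(\frac{\pi}{n}\right), & n\text{ even.}\end{cases}$$ Moreover $\eta(C_n)\to\frac{2}{\pi}$ as $n\to\infty$. -/

import Mathlib

open scoped ComplexOrder

noncomputable section

namespace IncompatibilityRobustness

/-- A family of binary observables `A v` on `ℂ^d` (Hermitian matrices with square `1`) whose
anti-commutativity graph is `G`: adjacent vertices, and only those, carry anti-commuting
observables, and non-adjacent vertices carry commuting observables. -/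
structure Realises {V : Type*} {d : ℕ} (A : V → Matrix (Fin d) (Fin d) ℂ)
    (G : SimpleGraph V) : Prop where
  isHermitian : ∀ v, (A v).IsHermitian
  sq_eq_one : ∀ v, A v ^ 2 = 1
  adj_iff : ∀ v w, G.Adj v w ↔ A v * A w = -(A w * A v)
  commute_of_not_adj : ∀ v w, ¬ G.Adj v w → A v * A w = A w * A v

/-- A positive operator valued measure on `ℂ^d` with finite outcome set `Ω`. -/
structure IsPOVM {Ω : Type*} [Fintype Ω] {d : ℕ} (E : Ω → Matrix (Fin d) (Fin d) ℂ) : Prop where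
  posSemidef : ∀ a, (E a).PosSemidef
  sum_eq_one : ∑ a, E a = 1

/-- Two-outcome measurements `M v`, with outcomes `±1` (the units of `ℤ`), are jointly measurable
if they are the marginals of a single parent POVM with outcomes `(a_v)_v ∈ {±1}^V`. -/
def JointlyMeasurable {V : Type*} [Fintype V] [DecidableEq V] {d : ℕ}
    (M : V → ℤˣ → Matrix (Fin d) (Fin d) ℂ) : Prop :=
  ∃ E : (V → ℤˣ) → Matrix (Fin d) (Fin d) ℂ, IsPOVM E ∧
    ∀ (v : V) (s : ℤˣ), ∑ a : V → ℤˣ with a v = s, E a = M v s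

/-- The noisy observable `A^η = η A + (tr A / d) (1 - η) 1`. -/
def noisy {d : ℕ} (η : ℝ) (A : Matrix (Fin d) (Fin d) ℂ) : Matrix (Fin d) (Fin d) ℂ :=
  (η : ℂ) • A + (A.trace / (d : ℂ) * (1 - (η : ℂ))) • (1 : Matrix (Fin d) (Fin d) ℂ)

/-- The effects `(1 ± B) / 2` of the two-outcome measurement of a binary observable `B`. -/
def effect {d : ℕ} (B : Matrix (Fin d) (Fin d) ℂ) (s : ℤˣ) : Matrix (Fin d) (Fin d) ℂ :=
  (1 / 2 : ℂ) • (1 + ((s : ℤ) : ℂ) • B)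

/-- The set of all `η ∈ [0,1]` for which the noisy observables `A_v^η` are jointly measurable. -/
def visibilities {V : Type*} [Fintype V] [DecidableEq V] {d : ℕ}
    (A : V → Matrix (Fin d) (Fin d) ℂ) : Set ℝ :=
  {η : ℝ | η ∈ Set.Icc (0 : ℝ) 1 ∧ JointlyMeasurable fun v => effect (noisy η (A v))}

/-- The incompatibility robustness `η(G)`: the largest visibility `η ∈ [0,1]` for which observables
with anti-commutativity graph `G` become jointly measurable. It is written as a supremum over all
realisations of `G`; that every single realisation attains it as a maximum is asserted separately
wherever it is used. -/
def eta {V : Type*} [Fintype V] [DecidableEq V] (G : SimpleGraph V) : ℝ :=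
  sSup {η : ℝ | ∃ d : ℕ, 0 < d ∧ ∃ A : V → Matrix (Fin d) (Fin d) ℂ,
    Realises A G ∧ η ∈ visibilities A}

end IncompatibilityRobustness

end

/-!
The value `η(Cₙ)` is `λ / n`, where `λ = ∑ₘ |sin ((2m + 1)π / n)|` (`bandSum n π`) is the
largest energy of a ring of free fermions.

*Upper bound* (`le_of_jointlyMeasurable`). If `E` is a parent measurement for `η A_v`, then
`∑ₐ a_v E(a) = η A_v`, hence `η n d = ∑ₐ tr (E(a) ∑_v a_v A_v)`. Since `(a_v A_v)_v` is again a
family with anti-commutativity graph `Cₙ`, it suffices that `∑_v A_v ≤ λ` for every such family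
(`posSemidef_sub_sum`). Read `A_j` as `i γ_j γ_{j+1}` with Majorana operators `γ_j`; only the pair
products `γ_0 γ_j` belong to the algebra generated by the `A_j`, but they are enough
(`majoranaPair`). The product around the whole cycle is a central Hermitian involution `U`, and on a
vector `x` of an eigenspace `U = ±1` the vectors `y_j = γ_0 γ_j x` are (anti)periodic and
real-orthogonal: their pairwise inner products are purely imaginary. The twisted
discrete Fourier transform diagonalises the shift `y_j ↦ y_{j+1}`, and opposite frequencies share a
fixed weight (`norm_sq_mode_le`); this bounds `⟨x, ∑ A_j x⟩` by the sum of the `|sin k|` over the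
admissible momenta `k` (`neg_im_sum_inner_succ_le`). The antiperiodic sum is the larger one (`bandSum_zero_le`).

*Lower bound* (`jointlyMeasurable_of_state`). Let `B` be any other family with the same graph and
`e` a basis vector with `⟨e, B_v e⟩ = η` for all `v`. The operators `A_v ⊗ B_v` commute, because the
signs cancel, so they have joint spectral projections; compressing these to `ℂ^d ⊗ e` gives a parent
measurement for `η A_v`. A suitable `B` is `B_j = i γ_j γ_{j+1}` (`exists_isCyclic_state`) with
`γ_j = n^{-1/2} ∑ₘ (uₘ^j bₘ + h.c.)`, where the `bₘ` are fermionic annihilation operators with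
vacuum `e` and `uₘ` is `exp (i (2m + 1)π / n)` or its conjugate, whichever makes mode `m` contribute
`+|sin ((2m + 1)π / n)|`.
-/

open scoped ComplexOrder

noncomputable section

namespace IncompatibilityRobustness

open Finset Complex

/-! ### Momenta and band sums -/

/-- The `m`-th momentum `(2πm + θ) / n` of a ring of `n` sites with boundary twist `θ`. -/
def angle (n : ℕ) (θ : ℝ) (m : ℕ) : ℝ := (2 * Real.pi * m + θ) / n

/-- The Fourier multiplier `exp (i k)` of the momentum `k = angle n θ m`. -/
def phase (n : ℕ) (θ : ℝ) (m : ℕ) : ℂ := exp (angle n θ m * I)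

/-- The sum of `|sin k|` over the momenta of a ring of `n` sites with boundary twist `θ`; the twist
is `0` for periodic and `π` for antiperiodic boundary conditions. -/
def bandSum (n : ℕ) (θ : ℝ) : ℝ := ∑ m ∈ range n, |Real.sin (angle n θ m)|

lemma phase_re (n : ℕ) (θ : ℝ) (m : ℕ) : (phase n θ m).re = Real.cos (angle n θ m) :=
  exp_ofReal_mul_I_re _

lemma phase_im (n : ℕ) (θ : ℝ) (m : ℕ) : (phase n θ m).im = Real.sin (angle n θ m) :=
  exp_ofReal_mul_I_im _

lemma phase_mul_conj (n : ℕ) (θ : ℝ) (m : ℕ) : phase n θ m * star (phase n θ m) = 1 := by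
  rw [star_def, mul_conj, normSq_eq_norm_sq, phase, norm_exp_ofReal_mul_I]; simp

lemma conj_mul_phase (n : ℕ) (θ : ℝ) (m : ℕ) : star (phase n θ m) * phase n θ m = 1 := by
  rw [mul_comm, phase_mul_conj]

lemma phase_pow_self {n : ℕ} (hn : 0 < n) (θ : ℝ) (m : ℕ) :
    phase n θ m ^ n = exp (θ * I) := by
  have hn' : (n : ℂ) ≠ 0 := by exact_mod_cast hn.ne'
  rw [phase, ← exp_nat_mul, angle]
  push_cast
  rw [show (n : ℂ) * ((2 * Real.pi * m + θ) / n * I) = θ * I + m * (2 * Real.pi * I) by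
    field_simp; ring]
  rw [exp_add, exp_nat_mul_two_pi_mul_I, mul_one]

lemma sum_phase_pow {n t : ℕ} (h0 : 0 < t) (ht : t < n) (θ : ℝ) :
    ∑ m ∈ range n, phase n θ m ^ t = 0 := by
  have hn : n ≠ 0 := by omega
  have hn' : (n : ℂ) ≠ 0 := by exact_mod_cast hn
  have hζ := Complex.isPrimitiveRoot_exp n hn
  set ζ := exp (2 * Real.pi * I / n) with hζd
  have h1 : ∀ m, phase n θ m ^ t = exp (θ / n * I) ^ t * (ζ ^ t) ^ m := by
    intro m
    rw [← pow_mul, mul_comm t m, pow_mul, ← mul_pow, hζd, ← exp_nat_mul _ m, ← exp_add, phase,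
      angle]
    push_cast
    congr 2
    field_simp; ring
  simp_rw [h1, ← mul_sum]
  have hne : ζ ^ t ≠ 1 := hζ.pow_ne_one_of_pos_of_lt h0.ne' ht
  have := mul_neg_geom_sum (ζ ^ t) n
  rw [← pow_mul, mul_comm t n, pow_mul, hζ.pow_eq_one, one_pow, sub_self] at this
  rcases mul_eq_zero.mp this with h | h
  · exact absurd (sub_eq_zero.mp h).symm hne
  · rw [h, mul_zero]

/-- Orthogonality of the twisted characters `j ↦ exp (i k j)`; it holds for any twist because
`j` and `l` lie in one period. -/
lemma sum_phase_pow_mul_conj {n j l : ℕ} (hj : j < n) (hl : l < n) (θ : ℝ) :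
    ∑ m ∈ range n, phase n θ m ^ j * star (phase n θ m) ^ l = if j = l then (n : ℂ) else 0 := by
  have key : ∀ (j l : ℕ) (z : ℂ), z * star z = 1 → l ≤ j → z ^ j * star z ^ l = z ^ (j - l) := by
    intro j l z hz h
    obtain ⟨k, rfl⟩ := Nat.exists_eq_add_of_le h
    rw [add_tsub_cancel_left, pow_add, mul_right_comm, ← mul_pow, hz, one_pow, one_mul]
  rcases lt_trichotomy j l with h | rfl | h
  · rw [if_neg h.ne]
    have := congrArg star (sum_phase_pow (n := n) (t := l - j) (by omega) (by omega) θ)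
    rw [star_sum, star_zero] at this
    rw [← this]
    refine sum_congr rfl fun m _ => ?_
    rw [← key l j _ (phase_mul_conj n θ m) h.le, star_mul, star_pow, star_pow, star_star]
  · rw [if_pos rfl, sum_congr rfl fun m _ => by rw [← mul_pow, phase_mul_conj, one_pow]]
    simp
  · rw [if_neg h.ne', ← sum_phase_pow (n := n) (t := j - l) (by omega) (by omega) θ]
    exact sum_congr rfl fun m _ => key j l _ (phase_mul_conj n θ m) h.le

lemma sum_sin_angle {n : ℕ} (hn : 1 < n) (θ : ℝ) : ∑ m ∈ range n, Real.sin (angle n θ m) = 0 := by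
  have := congrArg im (sum_phase_pow (t := 1) one_pos hn θ)
  simpa [phase_im] using this

lemma sum_cos_angle {n : ℕ} (hn : 1 < n) (θ : ℝ) : ∑ m ∈ range n, Real.cos (angle n θ m) = 0 := by
  have := congrArg re (sum_phase_pow (t := 1) one_pos hn θ)
  simpa [phase_re] using this

/-- If exactly the first `p` sines are non-negative, the sum of the absolute values is twice
the sum of those `p` sines, since all sines add up to zero, and that sum telescopes. -/
lemma sin_mul_bandSum {n p : ℕ} (hn : 1 < n) (hp : p ≤ n) (θ : ℝ)
    (hpos : ∀ m < p, 0 ≤ Real.sin (angle n θ m))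
    (hneg : ∀ m, p ≤ m → m < n → Real.sin (angle n θ m) ≤ 0) :
    Real.sin (Real.pi / n) * bandSum n θ =
      Real.cos ((θ - Real.pi) / n) - Real.cos ((θ + (2 * p - 1) * Real.pi) / n) := by
  have hn' : (n : ℝ) ≠ 0 := by positivity
  have h1 : bandSum n θ = 2 * ∑ m ∈ range p, Real.sin (angle n θ m) := by
    have hs := sum_sin_angle hn θ
    rw [← sum_range_add_sum_Ico _ hp] at hs
    rw [bandSum, ← sum_range_add_sum_Ico _ hp,
      sum_congr rfl fun m hm => abs_of_nonneg (hpos m (mem_range.mp hm)),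
      sum_congr rfl fun m hm => abs_of_nonpos
        (hneg m (mem_Ico.mp hm).1 (mem_Ico.mp hm).2), sum_neg_distrib]
    linarith
  have h2 : ∀ p : ℕ, 2 * (Real.sin (Real.pi / n) * ∑ m ∈ range p, Real.sin (angle n θ m)) =
      Real.cos ((θ - Real.pi) / n) - Real.cos ((θ + (2 * p - 1) * Real.pi) / n) := by
    intro p
    induction p with
    | zero => simp [sub_eq_add_neg]
    | succ p ih =>
      rw [sum_range_succ, mul_add, mul_add, ih]
      have e1 : (θ + (2 * (p : ℝ) - 1) * Real.pi) / n = angle n θ p - Real.pi / n := by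
        rw [angle]; field_simp; ring
      have e2 : (θ + (2 * ((p + 1 : ℕ) : ℝ) - 1) * Real.pi) / n = angle n θ p + Real.pi / n := by
        rw [angle]; push_cast; field_simp; ring
      rw [e1, e2, Real.cos_sub, Real.cos_add]; ring
  rw [h1, ← h2 p]; ring

lemma sin_angle_nonneg {n m : ℕ} {θ : ℝ} (hn : 0 < n) (h0 : 0 ≤ θ)
    (h : 2 * Real.pi * m + θ ≤ n * Real.pi) : 0 ≤ Real.sin (angle n θ m) := by
  have hn' : (0 : ℝ) < n := by exact_mod_cast hn
  have := Real.pi_pos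
  refine Real.sin_nonneg_of_nonneg_of_le_pi (by unfold angle; positivity) ?_
  rw [angle, div_le_iff₀ hn']; linarith

lemma sin_angle_nonpos {n m : ℕ} {θ : ℝ} (hn : 0 < n)
    (h : n * Real.pi ≤ 2 * Real.pi * m + θ) (h' : 2 * Real.pi * m + θ ≤ 2 * n * Real.pi) :
    Real.sin (angle n θ m) ≤ 0 := by
  have hn' : (0 : ℝ) < n := by exact_mod_cast hn
  rw [← Real.sin_sub_two_pi]
  refine Real.sin_nonpos_of_nonpos_of_neg_pi_le ?_ ?_
  · rw [sub_nonpos, angle, div_le_iff₀ hn']; linarith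
  · rw [neg_le_sub_iff_le_add, angle, ← sub_le_iff_le_add, le_div_iff₀ hn']; linarith

lemma sin_mul_bandSum_pi {n : ℕ} (hn : 1 < n) :
    Real.sin (Real.pi / n) * bandSum n Real.pi =
      1 - Real.cos (2 * ((n + 1) / 2 : ℕ) * Real.pi / n) := by
  have hpi := Real.pi_pos
  rw [sin_mul_bandSum (p := (n + 1) / 2) hn (by omega)]
  · rw [sub_self, zero_div, Real.cos_zero]
    congr 3; ring
  · intro m hm
    refine sin_angle_nonneg (by omega) hpi.le ?_
    have : ((2 * m + 1 : ℕ) : ℝ) ≤ n := by exact_mod_cast (by omega)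
    push_cast at this
    nlinarith
  · intro m hm hmn
    refine sin_angle_nonpos (by omega) ?_ ?_
    · have : (n : ℝ) ≤ ((2 * m + 1 : ℕ) : ℝ) := by exact_mod_cast (by omega)
      push_cast at this
      nlinarith
    · have : ((2 * m + 1 : ℕ) : ℝ) ≤ (2 * n : ℕ) := by exact_mod_cast (by omega)
      push_cast at this
      nlinarith

lemma sin_mul_bandSum_zero {n : ℕ} (hn : 1 < n) :
    Real.sin (Real.pi / n) * bandSum n 0 =
      Real.cos (Real.pi / n) - Real.cos ((2 * (n / 2 : ℕ) + 1) * Real.pi / n) := by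
  have hpi := Real.pi_pos
  rw [sin_mul_bandSum (p := n / 2 + 1) hn (by omega)]
  · rw [zero_sub, neg_div, Real.cos_neg]
    congr 3; push_cast; ring
  · intro m hm
    refine sin_angle_nonneg (by omega) le_rfl ?_
    have : ((2 * m : ℕ) : ℝ) ≤ n := by exact_mod_cast (by omega)
    push_cast at this
    nlinarith
  · intro m hm hmn
    refine sin_angle_nonpos (by omega) ?_ ?_
    · have : (n : ℝ) ≤ ((2 * m : ℕ) : ℝ) := by exact_mod_cast (by omega)
      push_cast at this
      nlinarith
    · have : ((2 * m : ℕ) : ℝ) ≤ (2 * n : ℕ) := by exact_mod_cast (by omega)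
      push_cast at this
      nlinarith

lemma sin_pi_div_pos {n : ℕ} (hn : 1 < n) : 0 < Real.sin (Real.pi / n) := by
  have hn' : (1 : ℝ) < n := by exact_mod_cast hn
  exact Real.sin_pos_of_pos_of_lt_pi (by positivity) (div_lt_self Real.pi_pos hn')

lemma bandSum_pi_of_even {n : ℕ} (hn : 1 < n) (h : Even n) :
    bandSum n Real.pi = 2 / Real.sin (Real.pi / n) := by
  rw [eq_div_iff (sin_pi_div_pos hn).ne', mul_comm, sin_mul_bandSum_pi hn]
  obtain ⟨k, rfl⟩ := h
  have hk : (k : ℝ) ≠ 0 := by norm_cast; omega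
  rw [show (k + k + 1) / 2 = k by omega]
  push_cast
  rw [show 2 * (k : ℝ) * Real.pi / (k + k) = Real.pi by field_simp; ring, Real.cos_pi]
  norm_num

lemma bandSum_pi_of_odd {n : ℕ} (hn : 1 < n) (h : Odd n) :
    bandSum n Real.pi = (1 + Real.cos (Real.pi / n)) / Real.sin (Real.pi / n) := by
  rw [eq_div_iff (sin_pi_div_pos hn).ne', mul_comm, sin_mul_bandSum_pi hn]
  obtain ⟨k, rfl⟩ := h
  have hk : (2 * (k : ℝ) + 1) ≠ 0 := by positivity
  rw [show (2 * k + 1 + 1) / 2 = k + 1 by omega]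
  push_cast
  rw [show 2 * ((k : ℝ) + 1) * Real.pi / (2 * k + 1) = Real.pi / (2 * k + 1) + Real.pi by
    field_simp; ring, Real.cos_add_pi]
  ring

/-- The antiperiodic band sum dominates the periodic one, so the choice of eigenspace of the central
element does not affect the bound. -/
lemma bandSum_zero_le {n : ℕ} (hn : 1 < n) : bandSum n 0 ≤ bandSum n Real.pi := by
  have hs := sin_pi_div_pos hn
  rcases Nat.even_or_odd n with h | h
  · rw [bandSum_pi_of_even hn h, le_div_iff₀ hs, mul_comm, sin_mul_bandSum_zero hn]
    linarith [Real.cos_le_one (Real.pi / n),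
      Real.neg_one_le_cos ((2 * (n / 2 : ℕ) + 1) * Real.pi / n)]
  · rw [bandSum_pi_of_odd hn h, le_div_iff₀ hs, mul_comm, sin_mul_bandSum_zero hn]
    linarith [Real.neg_one_le_cos ((2 * (n / 2 : ℕ) + 1) * Real.pi / n)]

lemma bandSum_nonneg (n : ℕ) (θ : ℝ) : 0 ≤ bandSum n θ := sum_nonneg fun _ _ => abs_nonneg _

lemma bandSum_div_le_one {n : ℕ} (hn : 0 < n) (θ : ℝ) : bandSum n θ / n ≤ 1 := by
  rw [div_le_one (by exact_mod_cast hn)]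
  calc bandSum n θ ≤ ∑ _m ∈ range n, (1 : ℝ) := sum_le_sum fun _ _ => Real.abs_sin_le_one _
    _ = n := by simp

lemma bandSum_div_of_odd {n : ℕ} (hn : 1 < n) (h : Odd n) :
    bandSum n Real.pi / n = 1 / (n : ℝ) * Real.cot (Real.pi / (2 * (n : ℝ))) := by
  have hn' : (1 : ℝ) < n := by exact_mod_cast hn
  set x := Real.pi / (2 * (n : ℝ)) with hx
  have e : Real.pi / n = 2 * x := by rw [hx]; field_simp
  have hs : 0 < Real.sin x := Real.sin_pos_of_pos_of_lt_pi (by positivity)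
    (div_lt_self Real.pi_pos (by linarith))
  have hs2 := sin_pi_div_pos hn
  rw [bandSum_pi_of_odd hn h, Real.cot_eq_cos_div_sin]
  rw [e, Real.sin_two_mul] at hs2
  have hc : Real.cos x ≠ 0 := fun hc => by simp [hc] at hs2
  rw [e, Real.sin_two_mul, Real.cos_two_mul]
  field_simp
  ring

lemma bandSum_div_of_even {n : ℕ} (hn : 1 < n) (h : Even n) :
    bandSum n Real.pi / n = 2 / (n : ℝ) * (1 / Real.sin (Real.pi / (n : ℝ))) := by
  rw [bandSum_pi_of_even hn h]; ring

lemma tendsto_bandSum_div :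
    Filter.Tendsto (fun n : ℕ => bandSum n Real.pi / n) Filter.atTop (nhds (2 / Real.pi)) := by
  have hpi := Real.pi_pos
  have hx : Filter.Tendsto (fun n : ℕ => Real.pi / (n : ℝ)) Filter.atTop (nhds 0) :=
    tendsto_const_div_atTop_nhds_zero_nat Real.pi
  have hsinc : Filter.Tendsto (fun n : ℕ => Real.sinc (Real.pi / (n : ℝ)))
      Filter.atTop (nhds 1) := by
    simpa [Function.comp_def] using (Real.continuous_sinc.tendsto 0).comp hx
  have hcos : Filter.Tendsto (fun n : ℕ => Real.cos (Real.pi / (n : ℝ))) Filter.atTop (nhds 1) := by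
    simpa [Function.comp_def] using (Real.continuous_cos.tendsto 0).comp hx
  have hup : Filter.Tendsto (fun n : ℕ => 2 / Real.pi / Real.sinc (Real.pi / (n : ℝ)))
      Filter.atTop (nhds (2 / Real.pi)) := by
    simpa [Pi.div_def] using (tendsto_const_nhds (x := 2 / Real.pi)).div hsinc one_ne_zero
  have hlow : Filter.Tendsto
      (fun n : ℕ => (1 + Real.cos (Real.pi / (n : ℝ))) / Real.pi / Real.sinc (Real.pi / (n : ℝ)))
      Filter.atTop (nhds (2 / Real.pi)) := by
    have := (((tendsto_const_nhds (x := (1 : ℝ))).add hcos).div_const Real.pi).div hsinc one_ne_zero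
    norm_num [Pi.div_def] at this
    exact this
  have hval : ∀ n : ℕ, 1 < n → ∀ c : ℝ,
      c / Real.sin (Real.pi / n) / n = c / Real.pi / Real.sinc (Real.pi / (n : ℝ)) := by
    intro n hn c
    have hn' : (n : ℝ) ≠ 0 := by positivity
    have hs := (sin_pi_div_pos hn).ne'
    rw [Real.sinc_of_ne_zero (by positivity)]
    field_simp
  -- Up to parity the value is one of the two bounds of this squeeze.
  have hle : ∀ n : ℕ, 1 < n →
      (1 + Real.cos (Real.pi / n)) / Real.sin (Real.pi / n) ≤ bandSum n Real.pi ∧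
        bandSum n Real.pi ≤ 2 / Real.sin (Real.pi / n) := by
    intro n hn
    have hs := sin_pi_div_pos hn
    have hc : 1 + Real.cos (Real.pi / n) ≤ 2 := by linarith [Real.cos_le_one (Real.pi / n)]
    have h2 := div_le_div_of_nonneg_right hc hs.le
    rcases Nat.even_or_odd n with h | h
    · rw [bandSum_pi_of_even hn h]
      exact ⟨h2, le_rfl⟩
    · rw [bandSum_pi_of_odd hn h]
      exact ⟨le_rfl, h2⟩
  refine tendsto_of_tendsto_of_tendsto_of_le_of_le' hlow hup ?_ ?_
  · filter_upwards [Filter.eventually_gt_atTop 1] with n hn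
    rw [← hval n hn]
    exact div_le_div_of_nonneg_right (hle n hn).1 (Nat.cast_nonneg n)
  · filter_upwards [Filter.eventually_gt_atTop 1] with n hn
    rw [← hval n hn]
    exact div_le_div_of_nonneg_right (hle n hn).2 (Nat.cast_nonneg n)

/-! ### Twisted Fourier transform of a real-orthogonal sequence -/

section Fourier

variable {E : Type*} [NormedAddCommGroup E] [InnerProductSpace ℂ E]

/-- The (unnormalised) Fourier coefficient `∑ⱼ w̄ʲ yⱼ` of a sequence of vectors. -/
def mode (n : ℕ) (y : ℕ → E) (w : ℂ) : E := ∑ j ∈ range n, star w ^ j • y j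

lemma inner_mode (n : ℕ) (y y' : ℕ → E) (w : ℂ) :
    inner ℂ (mode n y w) (mode n y' w) =
      ∑ j ∈ range n, ∑ l ∈ range n, w ^ j * star w ^ l * inner ℂ (y j) (y' l) := by
  simp only [mode, sum_inner, inner_smul_left]
  refine sum_congr rfl fun j _ => ?_
  rw [inner_sum, mul_sum]
  refine sum_congr rfl fun l _ => ?_
  rw [inner_smul_right]
  simp only [star_def, map_pow, conj_conj]
  ring

/-- Parseval's identity for the twisted Fourier transform. -/
lemma sum_inner_mode (n : ℕ) (θ : ℝ) (y y' : ℕ → E) :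
    ∑ m ∈ range n, inner ℂ (mode n y (phase n θ m)) (mode n y' (phase n θ m)) =
      n * ∑ j ∈ range n, inner ℂ (y j) (y' j) := by
  simp only [inner_mode]
  rw [sum_comm, mul_sum]
  refine sum_congr rfl fun j hj => ?_
  rw [sum_comm]
  simp only [← sum_mul]
  rw [sum_congr rfl fun l hl => by
    rw [sum_phase_pow_mul_conj (mem_range.mp hj) (mem_range.mp hl) θ]]
  simp [mem_range.mp hj]

/-- Shifting a sequence that is quasi-periodic with multiplier `w ^ n` multiplies its mode
by `w`. -/
lemma mode_shift {n : ℕ} {y : ℕ → E} {w : ℂ} (hw : w * star w = 1)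
    (hy : y n = w ^ n • y 0) : mode n (fun j => y (j + 1)) w = w • mode n y w := by
  have h1 : ∑ j ∈ range n, w • star w ^ (j + 1) • y (j + 1) = mode n (fun j => y (j + 1)) w := by
    refine sum_congr rfl fun j _ => ?_
    rw [smul_smul, pow_succ', ← mul_assoc, hw, one_mul]
  have h2 : ∑ j ∈ range n, star w ^ (j + 1) • y (j + 1) = mode n y w := by
    have e := (sum_range_succ' (fun j => star w ^ j • y j) n).symm.trans
      (sum_range_succ (fun j => star w ^ j • y j) n)
    have e2 : star w ^ n • y n = y 0 := by
      rw [hy, smul_smul, ← mul_pow, mul_comm, hw, one_pow, one_smul]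
    rw [e2, pow_zero, one_smul] at e
    exact add_right_cancel e
  rw [← h1, ← h2, smul_sum]

/-- For a real-orthogonal sequence the modes at `w` and `w̄` have total squared norm `2 n q`. -/
lemma norm_sq_mode_le {n : ℕ} {y : ℕ → E} {q : ℝ} {w : ℂ} (hw : w * star w = 1)
    (hdiag : ∀ j < n, ‖y j‖ ^ 2 = q)
    (hoff : ∀ j < n, ∀ l < n, j ≠ l → (inner ℂ (y j) (y l)).re = 0) :
    ‖mode n y w‖ ^ 2 ≤ 2 * n * q := by
  have hdiag' : ∀ j < n, inner ℂ (y j) (y j) = (q : ℂ) := fun j hj => by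
    rw [inner_self_eq_norm_sq_to_K, ← hdiag j hj]; simp
  have key : ‖mode n y w‖ ^ 2 + ‖mode n y (star w)‖ ^ 2 = 2 * n * q := by
    have e : ∀ z : E, ‖z‖ ^ 2 = (inner ℂ z z).re := fun z =>
      (inner_self_eq_norm_sq (𝕜 := ℂ) z).symm
    rw [e, e, inner_mode, inner_mode, ← add_re, ← sum_add_distrib, re_sum]
    have : ∀ j ∈ range n, (∑ l ∈ range n, w ^ j * star w ^ l * inner ℂ (y j) (y l) +
        ∑ l ∈ range n, star w ^ j * star (star w) ^ l * inner ℂ (y j) (y l)).re = 2 * q := by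
      intro j hj
      rw [← sum_add_distrib, re_sum, sum_eq_single_of_mem j hj]
      · have h1 : w ^ j * star w ^ j = 1 := by rw [← mul_pow, hw, one_pow]
        have h2 : star w ^ j * star (star w) ^ j = 1 := by
          rw [star_star, ← mul_pow, mul_comm, hw, one_pow]
        rw [h1, h2, hdiag' j (mem_range.mp hj)]
        simp; ring
      · intro l hl hlj
        have h0 := hoff j (mem_range.mp hj) l (mem_range.mp hl) hlj.symm
        have h3 : star w ^ j * star (star w) ^ l = star (w ^ j * star w ^ l) := by
          rw [star_mul, star_pow, star_pow, mul_comm]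
        rw [h3, ← add_mul, star_def, add_conj, mul_re, h0]
        simp
    rw [sum_congr rfl this]
    simp; ring
  nlinarith [sq_nonneg ‖mode n y (star w)‖]

/-- A nearest-neighbour correlation of real-orthogonal vectors of equal length, closed up with the
twist `θ`, is at most the band sum. This is the inequality `tr (K S) ≤ ‖S‖₁` for the contraction
`K` of imaginary parts of inner products and the twisted shift `S`. -/
lemma neg_im_sum_inner_succ_le {n : ℕ} (hn : 1 < n) {θ : ℝ} {y : ℕ → E} {q : ℝ}
    (hdiag : ∀ j < n, ‖y j‖ ^ 2 = q)
    (hoff : ∀ j < n, ∀ l < n, j ≠ l → (inner ℂ (y j) (y l)).re = 0)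
    (hy : y n = exp (θ * I) • y 0) :
    -(∑ j ∈ range n, inner ℂ (y j) (y (j + 1))).im ≤ bandSum n θ * q := by
  have hn0 : (0 : ℝ) < n := by exact_mod_cast (by omega)
  have hpars := sum_inner_mode n θ y (fun j => y (j + 1))
  have hterm : ∀ m, inner ℂ (mode n y (phase n θ m)) (mode n (fun j => y (j + 1)) (phase n θ m)) =
      phase n θ m * ((‖mode n y (phase n θ m)‖ ^ 2 : ℝ) : ℂ) := by
    intro m
    rw [mode_shift (phase_mul_conj n θ m) (by rw [phase_pow_self (by omega), hy]), inner_smul_right,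
      inner_self_eq_norm_sq_to_K]
    simp
  simp only [hterm] at hpars
  have him := congrArg im hpars
  rw [im_sum] at him
  simp only [im_mul_ofReal, phase_im] at him
  rw [← ofReal_natCast, im_ofReal_mul] at him
  -- For `sin ≥ 0` the left side is at most `0`; for `sin < 0` the bound `‖mode‖² ≤ 2nq` is used.
  have hle : ∀ m ∈ range n, -(Real.sin (angle n θ m) * ‖mode n y (phase n θ m)‖ ^ 2) ≤
      n * q * (|Real.sin (angle n θ m)| - Real.sin (angle n θ m)) := by
    intro m _
    have h1 := norm_sq_mode_le (phase_mul_conj n θ m) hdiag hoff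
    have h2 := sq_nonneg ‖mode n y (phase n θ m)‖
    rcases le_total 0 (Real.sin (angle n θ m)) with h | h
    · rw [abs_of_nonneg h, sub_self, mul_zero]
      linarith [mul_nonneg h h2]
    · rw [abs_of_nonpos h]
      nlinarith
  have hsum := sum_le_sum hle
  rw [sum_neg_distrib, him, ← mul_sum, sum_sub_distrib, sum_sin_angle hn, sub_zero] at hsum
  change _ ≤ n * q * bandSum n θ at hsum
  refine le_of_mul_le_mul_left ?_ hn0
  linarith

end Fourier

/-! ### Largest eigenvalue of the sum of a cyclic family -/

lemma mod_of_lt_two_mul {n x : ℕ} (hx : x < 2 * n) : x % n = if x < n then x else x - n := by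
  split_ifs with h
  · exact Nat.mod_eq_of_lt h
  · rw [Nat.mod_eq_sub_mod (by omega), Nat.mod_eq_of_lt (by omega)]

lemma cycleGraph_adj_val {n : ℕ} (hn : 3 ≤ n) (u v : Fin n) :
    (SimpleGraph.cycleGraph n).Adj u v ↔
      u.val + 1 = v.val ∨ v.val + 1 = u.val ∨ (u.val = 0 ∧ v.val + 1 = n) ∨
        (v.val = 0 ∧ u.val + 1 = n) := by
  have hu := u.isLt
  have hv := v.isLt
  rw [SimpleGraph.cycleGraph_adj', Fin.sub_def, Fin.sub_def]
  simp only
  rw [mod_of_lt_two_mul (by omega), mod_of_lt_two_mul (by omega)]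
  split_ifs <;> omega

/-- The vertex of `Cₙ` with number `j` modulo `n`. -/
def wrap {n : ℕ} (hn : 3 ≤ n) (j : ℕ) : Fin n := ⟨j % n, Nat.mod_lt _ (by omega)⟩

lemma wrap_val {n : ℕ} (hn : 3 ≤ n) (v : Fin n) : wrap hn v = v :=
  Fin.ext (Nat.mod_eq_of_lt v.isLt)

lemma add_mod_of_lt {n : ℕ} (j : ℕ) {t : ℕ} (ht : t < n) :
    (j + t) % n = if j % n + t < n then j % n + t else j % n + t - n := by
  have := Nat.mod_lt j (show 0 < n by omega)
  rw [Nat.add_mod, Nat.mod_eq_of_lt ht, mod_of_lt_two_mul (by omega)]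

lemma adj_wrap_succ {n : ℕ} (hn : 3 ≤ n) (j : ℕ) :
    (SimpleGraph.cycleGraph n).Adj (wrap hn j) (wrap hn (j + 1)) := by
  have := Nat.mod_lt j (show 0 < n by omega)
  rw [cycleGraph_adj_val hn]
  simp only [wrap]
  rw [add_mod_of_lt j (by omega)]
  split_ifs <;> omega

lemma not_adj_wrap {n : ℕ} (hn : 3 ≤ n) {j m : ℕ} (h1 : j + 2 ≤ m) (h2 : m + 2 ≤ j + n) :
    ¬ (SimpleGraph.cycleGraph n).Adj (wrap hn j) (wrap hn m) := by
  obtain ⟨t, rfl⟩ := Nat.exists_eq_add_of_le (show j ≤ m by omega)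
  have := Nat.mod_lt j (show 0 < n by omega)
  rw [cycleGraph_adj_val hn]
  simp only [wrap]
  rw [add_mod_of_lt j (by omega)]
  split_ifs <;> omega

/-- Self-adjoint involutions in a star ring, indexed by the vertices of `Cₙ`, that anti-commute
along edges and commute otherwise. -/
structure IsCyclic {R : Type*} [Ring R] [StarRing R] {n : ℕ} (A : Fin n → R) : Prop where
  star_eq : ∀ v, star (A v) = A v
  mul_self : ∀ v, A v * A v = 1
  anti : ∀ v w, (SimpleGraph.cycleGraph n).Adj v w → A v * A w = -(A w * A v)
  comm : ∀ v w, ¬ (SimpleGraph.cycleGraph n).Adj v w → A v * A w = A w * A v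

section Algebra

variable {R : Type*} [Ring R] [StarRing R] [Algebra ℂ R] [StarModule ℂ R]

/-- The product `(-i)ˡ a₀ a₁ ⋯ a_{l-1}`. If `a_j = i γ_j γ_{j+1}` with Majorana operators `γ_j`, this
is `γ₀ γ_l`. -/
def majoranaPair (a : ℕ → R) : ℕ → R
  | 0 => 1
  | l + 1 => (-I) • (majoranaPair a l * a l)

lemma star_mul_majoranaPair {a : ℕ → R} (hstar : ∀ j, star (a j) = a j)
    (hsq : ∀ j, a j * a j = 1) (l : ℕ) : star (majoranaPair a l) * majoranaPair a l = 1 := by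
  induction l with
  | zero => simp [majoranaPair]
  | succ l ih =>
    rw [majoranaPair, star_smul, star_mul, hstar, smul_mul_smul_comm, mul_assoc,
      ← mul_assoc (star _), ih, one_mul, hsq]
    simp

lemma star_majoranaPair_mul_succ {a : ℕ → R} (hstar : ∀ j, star (a j) = a j)
    (hsq : ∀ j, a j * a j = 1) (l : ℕ) :
    star (majoranaPair a l) * majoranaPair a (l + 1) = (-I) • a l := by
  rw [majoranaPair, mul_smul_comm, ← mul_assoc, star_mul_majoranaPair hstar hsq, one_mul]

/-- `γ_j γ_l` is anti-self-adjoint for `0 < l - j < n`. The indices `j, …, l - 1` form a path in the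
cycle, so only neighbouring factors anti-commute. -/
lemma star_majoranaPair_mul_of_lt {n : ℕ} {a : ℕ → R}
    (hstar : ∀ j, star (a j) = a j) (hsq : ∀ j, a j * a j = 1)
    (hanti : ∀ j, a j * a (j + 1) = -(a (j + 1) * a j))
    (hcomm : ∀ j m, j + 2 ≤ m → m + 2 ≤ j + n → a j * a m = a m * a j) {j l : ℕ}
    (hjl : j + 1 ≤ l) (hl : l < j + n) :
    star (star (majoranaPair a j) * majoranaPair a l) =
      -(star (majoranaPair a j) * majoranaPair a l) := by
  -- The induction also needs how `γ_j γ_l` commutes with the factors still to come.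
  suffices H : ∀ l, j + 1 ≤ l → l < j + n →
      star (star (majoranaPair a j) * majoranaPair a l) =
        -(star (majoranaPair a j) * majoranaPair a l) ∧
      (l + 1 < j + n → star (majoranaPair a j) * majoranaPair a l * a l =
        -(a l * (star (majoranaPair a j) * majoranaPair a l))) ∧
      ∀ m, l < m → m + 2 ≤ j + n → star (majoranaPair a j) * majoranaPair a l * a m =
        a m * (star (majoranaPair a j) * majoranaPair a l) from (H l hjl hl).1
  intro l hjl
  induction l, hjl using Nat.le_induction with
  | base =>
    intro _
    rw [star_majoranaPair_mul_succ hstar hsq]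
    refine ⟨?_, fun _ => ?_, fun m h1 h2 => ?_⟩
    · rw [star_smul, hstar]; simp
    · rw [smul_mul_assoc, hanti, mul_smul_comm, smul_neg]
    · rw [smul_mul_assoc, hcomm j m (by omega) h2, mul_smul_comm]
  | succ l hjl ih =>
    intro hl
    obtain ⟨ih1, ih2, ih3⟩ := ih (by omega)
    have ih2 := ih2 hl
    have e : star (majoranaPair a j) * majoranaPair a (l + 1) =
        (-I) • (star (majoranaPair a j) * majoranaPair a l * a l) := by
      rw [majoranaPair, mul_smul_comm, mul_assoc]
    rw [e]
    set V := star (majoranaPair a j) * majoranaPair a l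
    refine ⟨?_, fun h => ?_, fun m h1 h2 => ?_⟩
    · rw [star_smul, star_mul, hstar, ih1, ih2]
      simp
    · rw [smul_mul_assoc, mul_smul_comm, mul_assoc, hanti, mul_neg, ← mul_assoc,
        ih3 (l + 1) (by omega) (by omega), mul_assoc, smul_neg]
    · rw [smul_mul_assoc, mul_smul_comm, mul_assoc, hcomm l m (by omega) (by omega), ← mul_assoc,
        ih3 m (by omega) h2, mul_assoc]

variable {n : ℕ} {A : Fin n → R}

open Classical in
omit [StarModule ℂ R] in
/-- Moving `A v` through the product collects one sign for each neighbour of `v`. -/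
lemma majoranaPair_mul_comm_sign (hn : 3 ≤ n) (hA : IsCyclic A) (v : Fin n) (l : ℕ) :
    majoranaPair (fun j => A (wrap hn j)) l * A v =
      (∏ j ∈ range l, if (SimpleGraph.cycleGraph n).Adj (wrap hn j) v then (-1 : ℂ) else 1) •
        (A v * majoranaPair (fun j => A (wrap hn j)) l) := by
  induction l with
  | zero => simp [majoranaPair]
  | succ l ih =>
    have h : A (wrap hn l) * A v =
        (if (SimpleGraph.cycleGraph n).Adj (wrap hn l) v then (-1 : ℂ) else 1) •
          (A v * A (wrap hn l)) := by
      split_ifs with h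
      · rw [hA.anti _ _ h]; simp
      · rw [hA.comm _ _ h]; simp
    rw [prod_range_succ, majoranaPair, smul_mul_assoc, mul_assoc, h, mul_smul_comm, ← mul_assoc, ih,
      smul_mul_assoc, mul_smul_comm, smul_smul, smul_smul, smul_smul, mul_assoc]
    congr 1
    · ring
    · rw [mul_assoc]

omit [StarModule ℂ R] in
/-- The ordered product around the cycle is central: each vertex has two neighbours, so the
signs cancel. -/
lemma majoranaPair_cycle_commute (hn : 3 ≤ n) (hA : IsCyclic A) (v : Fin n) :
    Commute (majoranaPair (fun j => A (wrap hn j)) n) (A v) := by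
  classical
  rw [commute_iff_eq, majoranaPair_mul_comm_sign hn hA v n, prod_range]
  simp only [wrap_val]
  rw [prod_ite, prod_const, prod_const_one, mul_one]
  obtain ⟨k, rfl⟩ : ∃ k, n = k + 3 := ⟨n - 3, by omega⟩
  have hdeg : #{x | (SimpleGraph.cycleGraph (k + 3)).Adj x v} = 2 := by
    rw [← SimpleGraph.cycleGraph_degree_three_le (v := v),
      ← SimpleGraph.card_neighborFinset_eq_degree]
    congr 1
    ext x
    simp [SimpleGraph.adj_comm]
  rw [hdeg]
  simp

lemma star_majoranaPair_cycle (hn : 3 ≤ n) (hA : IsCyclic A) :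
    star (majoranaPair (fun j => A (wrap hn j)) n) = majoranaPair (fun j => A (wrap hn j)) n := by
  obtain ⟨k, rfl⟩ : ∃ k, n = k + 1 := ⟨n - 1, by omega⟩
  set a : ℕ → R := fun j => A (wrap hn j) with ha
  have hc := majoranaPair_cycle_commute hn hA (wrap hn k)
  have hanti : star (majoranaPair a k) = -majoranaPair a k := by
    have := star_majoranaPair_mul_of_lt (a := a) (fun j => hA.star_eq _)
      (fun j => hA.mul_self _) (fun j => hA.anti _ _ (adj_wrap_succ hn j))
      (fun j m h1 h2 => hA.comm _ _ (not_adj_wrap hn h1 h2)) (j := 0) (l := k) (by omega) (by omega)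
    simpa [majoranaPair] using this
  change Commute (majoranaPair a (k + 1)) (a k) at hc
  have hU : majoranaPair a (k + 1) * a k = (-I) • majoranaPair a k := by
    rw [majoranaPair, smul_mul_assoc, mul_assoc, ha]
    simp only
    rw [hA.mul_self, mul_one]
  have hU' : a k * majoranaPair a (k + 1) = (-I) • majoranaPair a k := by rw [← hc.eq, hU]
  have h2 : a k * majoranaPair a k = majoranaPair a k * a k := by
    have e1 : a k * majoranaPair a (k + 1) * a k = (-I) • (majoranaPair a k * a k) := by
      rw [hU', smul_mul_assoc]
    rw [mul_assoc, hU, mul_smul_comm] at e1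
    exact smul_right_injective R (neg_ne_zero.mpr I_ne_zero) e1
  rw [majoranaPair, star_smul, star_mul, hanti, show star (a k) = a k from hA.star_eq _, mul_neg,
    h2]
  simp

end Algebra

section Hilbert

variable {E : Type*} [NormedAddCommGroup E] [InnerProductSpace ℂ E] [CompleteSpace E]
  {n : ℕ} {A : Fin n → E →L[ℂ] E}

lemma inner_apply_apply (S T : E →L[ℂ] E) (x y : E) :
    inner ℂ (S x) (T y) = inner ℂ x ((star S * T) y) := by
  rw [mul_apply_eq_comp, ContinuousLinearMap.star_eq_adjoint,
    ContinuousLinearMap.adjoint_inner_right]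

lemma re_inner_eq_zero_of_star_eq_neg {T : E →L[ℂ] E} (hT : star T = -T) (x : E) :
    (inner ℂ x (T x)).re = 0 := by
  have h1 := inner_apply_apply T 1 x x
  rw [mul_one, hT] at h1
  simp only [one_apply_eq_self, neg_apply, inner_neg_right] at h1
  have h2 := congrArg re h1
  rw [neg_re, ← inner_conj_symm, conj_re] at h2
  linarith

/-- The bound on an eigenspace of the product around the cycle: there the Majorana vectors
`γ₀ γ_j x` close up with the twist `θ`. -/
lemma re_inner_sum_le_sector (hn : 3 ≤ n) (hA : IsCyclic A) {θ : ℝ} {x : E}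
    (hx : majoranaPair (fun j => A (wrap hn j)) n x = exp (θ * I) • x) :
    (inner ℂ x ((∑ v, A v) x)).re ≤ bandSum n θ * ‖x‖ ^ 2 := by
  set a : ℕ → E →L[ℂ] E := fun j => A (wrap hn j) with ha
  have hstar : ∀ j, star (a j) = a j := fun j => hA.star_eq _
  have hsq : ∀ j, a j * a j = 1 := fun j => hA.mul_self _
  have hlt : ∀ j l, j < l → l < n →
      (inner ℂ (majoranaPair a j x) (majoranaPair a l x)).re = 0 := by
    intro j l hjl hl
    rw [inner_apply_apply]
    exact re_inner_eq_zero_of_star_eq_neg (star_majoranaPair_mul_of_lt hstar hsq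
      (fun j => hA.anti _ _ (adj_wrap_succ hn j))
      (fun j m h1 h2 => hA.comm _ _ (not_adj_wrap hn h1 h2)) hjl (by omega)) x
  have key := neg_im_sum_inner_succ_le (n := n) (by omega) (θ := θ)
    (y := fun j => majoranaPair a j x) (q := ‖x‖ ^ 2) ?_ ?_ ?_
  · refine le_trans (le_of_eq ?_) key
    simp only [inner_apply_apply, star_majoranaPair_mul_succ hstar hsq]
    rw [_root_.sum_apply, inner_sum, re_sum, im_sum, sum_range, ← sum_neg_distrib]
    refine sum_congr rfl fun v _ => ?_
    simp only [ha, wrap_val, smul_apply, inner_smul_right]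
    simp
  · intro j _
    rw [← inner_self_eq_norm_sq (𝕜 := ℂ), inner_apply_apply, star_mul_majoranaPair hstar hsq,
      one_apply_eq_self, inner_self_eq_norm_sq]
  · intro j hj l hl hjl
    rcases lt_or_gt_of_ne hjl with h | h
    · exact hlt j l h hl
    · rw [← inner_conj_symm, conj_re]
      exact hlt l j h hj
  · simpa [majoranaPair] using hx

/-- The product around the cycle is a central self-adjoint involution, so every vector splits into
periodic and antiperiodic parts, between which `∑ A v` has no matrix elements. -/
lemma re_inner_sum_le (hn : 3 ≤ n) (hA : IsCyclic A) (x : E) :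
    (inner ℂ x ((∑ v, A v) x)).re ≤ bandSum n Real.pi * ‖x‖ ^ 2 := by
  set U := majoranaPair (fun j => A (wrap hn j)) n with hU
  have hUs : star U = U := star_majoranaPair_cycle hn hA
  have hUU : U * U = 1 := by
    nth_rewrite 1 [← hUs]
    exact star_mul_majoranaPair (fun j => hA.star_eq _) (fun j => hA.mul_self _) n
  have hUH : U * (∑ v, A v) = (∑ v, A v) * U :=
    (Commute.sum_right _ _ _ fun v _ => majoranaPair_cycle_commute hn hA v).eq
  set H := ∑ v, A v
  -- `u` and `v` are the components of `x` in the eigenspaces `U = 1` and `U = -1`.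
  set u : E := (2⁻¹ : ℂ) • (x + U x) with hu
  set v : E := (2⁻¹ : ℂ) • (x - U x) with hv
  have hUUx : U (U x) = x := by rw [← mul_apply_eq_comp, hUU]; rfl
  have hUu : U u = u := by rw [hu, map_smul, map_add, hUUx, add_comm]
  have hUv : U v = -v := by rw [hv, map_smul, map_sub, hUUx, ← smul_neg, neg_sub]
  have hxuv : x = u + v := by rw [hu, hv]; module
  have hcross : ∀ T : E →L[ℂ] E, U * T = T * U → inner ℂ u (T v) = 0 := by
    intro T hT
    have h1 := inner_apply_apply U T u v
    rw [hUs, hT, hUu, mul_apply_eq_comp, hUv, map_neg, inner_neg_right] at h1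
    exact self_eq_neg.mp h1
  have hcross' : ∀ T : E →L[ℂ] E, U * T = T * U → inner ℂ v (T u) = 0 := by
    intro T hT
    have h1 := inner_apply_apply U T v u
    rw [hUs, hT, hUv, mul_apply_eq_comp, hUu, inner_neg_left] at h1
    exact neg_eq_self.mp h1
  have hsplit : ∀ T : E →L[ℂ] E, U * T = T * U →
      inner ℂ x (T x) = inner ℂ u (T u) + inner ℂ v (T v) := by
    intro T hT
    rw [hxuv, map_add, inner_add_left, inner_add_right, inner_add_right, hcross T hT, hcross' T hT]
    ring
  have hnorm : ‖x‖ ^ 2 = ‖u‖ ^ 2 + ‖v‖ ^ 2 := by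
    have := congrArg re (hsplit 1 (by rw [mul_one, one_mul]))
    simp only [one_apply_eq_self, add_re] at this
    rw [← inner_self_eq_norm_sq (𝕜 := ℂ), ← inner_self_eq_norm_sq (𝕜 := ℂ),
      ← inner_self_eq_norm_sq (𝕜 := ℂ)]
    exact this
  have h0 := re_inner_sum_le_sector hn hA (θ := 0) (x := u) (by rw [← hU, hUu]; simp)
  have h1 := re_inner_sum_le_sector hn hA (θ := Real.pi) (x := v) (by
    rw [← hU, hUv]; simp)
  have hle := mul_le_mul_of_nonneg_right (bandSum_zero_le (n := n) (by omega)) (sq_nonneg ‖u‖)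
  rw [hsplit H hUH, add_re, hnorm]
  linarith

end Hilbert

section Matrix

variable {n d : ℕ} {A : Fin n → Matrix (Fin d) (Fin d) ℂ}

lemma Realises.isCyclic (hA : Realises A (SimpleGraph.cycleGraph n)) : IsCyclic A where
  star_eq v := hA.isHermitian v
  mul_self v := by rw [← sq, hA.sq_eq_one]
  anti v w h := (hA.adj_iff v w).mp h
  comm v w h := hA.commute_of_not_adj v w h

lemma IsCyclic.map {R S F : Type*} [Ring R] [StarRing R] [Ring S] [StarRing S] [FunLike F R S]
    [RingHomClass F R S] [StarHomClass F R S] {A : Fin n → R} (hA : IsCyclic A) (f : F) :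
    IsCyclic (fun v => f (A v)) where
  star_eq v := by rw [← map_star, hA.star_eq]
  mul_self v := by rw [← map_mul, hA.mul_self, map_one]
  anti v w h := by rw [← map_mul, ← map_mul, hA.anti v w h, map_neg]
  comm v w h := by rw [← map_mul, ← map_mul, hA.comm v w h]

lemma posSemidef_sub_sum (hn : 3 ≤ n) (hA : IsCyclic A) :
    ((bandSum n Real.pi : ℂ) • (1 : Matrix (Fin d) (Fin d) ℂ) - ∑ v, A v).PosSemidef := by
  set f := Matrix.toEuclideanCLM (n := Fin d) (𝕜 := ℂ)
  set M := (bandSum n Real.pi : ℂ) • (1 : Matrix (Fin d) (Fin d) ℂ) - ∑ v, A v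
  have hA' : IsCyclic (fun v => f (A v)) := hA.map f
  rw [← Matrix.isPositive_toEuclideanLin_iff]
  have hM : M.IsHermitian := by
    change star M = M
    simp only [M, star_sub, star_smul, star_sum, hA.star_eq, star_one]
    simp
  refine ⟨Matrix.isSymmetric_toEuclideanLin_iff.mpr hM, fun x => ?_⟩
  have h := re_inner_sum_le hn hA' x
  change 0 ≤ (inner ℂ (f M x) x).re
  have e : f M x = (bandSum n Real.pi : ℂ) • x - (∑ v, f (A v)) x := by
    simp only [M, map_sub, map_smul, map_one, map_sum]
    rfl
  rw [e, ← inner_conj_symm, conj_re, inner_sub_right, sub_re, inner_smul_right, re_ofReal_mul]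
  have hx : (inner ℂ x x).re = ‖x‖ ^ 2 := inner_self_eq_norm_sq (𝕜 := ℂ) x
  rw [hx]
  linarith

end Matrix

/-! ### Fermionic realisation of the cycle -/

open Matrix
open scoped Kronecker

/-- The first `N` operators of `b` satisfy the canonical anti-commutation relations, and the basis
vector `e` is a vacuum: it is annihilated by all of them. -/
structure IsFock {ι : Type*} [Fintype ι] [DecidableEq ι] (N : ℕ) (b : ℕ → Matrix ι ι ℂ)
    (e : ι) : Prop where
  anti : ∀ m < N, ∀ l < N, b m * b l + b l * b m = 0
  anti_star : ∀ m < N, ∀ l < N, b m * (b l)ᴴ + (b l)ᴴ * b m = if m = l then 1 else 0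
  vacuum : ∀ m < N, ∀ x, b m x e = 0

/-- Jordan–Wigner construction: adding a mode tensors the old operators with the Pauli matrix `Z`. -/
lemma exists_isFock (N : ℕ) : ∃ (ι : Type) (_ : Fintype ι) (_ : DecidableEq ι)
    (b : ℕ → Matrix ι ι ℂ) (e : ι), IsFock N b e := by
  induction N with
  | zero => exact ⟨Unit, inferInstance, inferInstance, fun _ => 0, (), by simp, by simp, by simp⟩
  | succ N ih =>
    obtain ⟨ι, _, _, b, e, hb⟩ := ih
    let Z : Matrix (Fin 2) (Fin 2) ℂ := !![1, 0; 0, -1]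
    let σ : Matrix (Fin 2) (Fin 2) ℂ := !![0, 1; 0, 0]
    have hZ : Zᴴ = Z := by ext i j; fin_cases i <;> fin_cases j <;> simp [Z]
    have hZZ : Z * Z = 1 := by ext i j; fin_cases i <;> fin_cases j <;> simp [Z]
    have hZσ : Z * σ = σ := by ext i j; fin_cases i <;> fin_cases j <;> simp [Z, σ]
    have hσZ : σ * Z = -σ := by ext i j; fin_cases i <;> fin_cases j <;> simp [Z, σ]
    have hZσ' : Z * σᴴ = -σᴴ := by rw [← hZ, ← conjTranspose_mul, hσZ, conjTranspose_neg]
    have hσZ' : σᴴ * Z = σᴴ := by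
      nth_rewrite 1 [← hZ]
      rw [← conjTranspose_mul, hZσ]
    have hσσ : σ * σ = 0 := by ext i j; fin_cases i <;> fin_cases j <;> simp [σ]
    have hσσ' : σ * σᴴ + σᴴ * σ = 1 := by
      have hσs : σᴴ = !![0, 0; 1, 0] := by ext i j; fin_cases i <;> fin_cases j <;> simp [σ]
      rw [hσs]
      ext i j; fin_cases i <;> fin_cases j <;> simp [σ]
    refine ⟨ι × Fin 2, inferInstance, inferInstance,
      fun m => if m < N then b m ⊗ₖ Z else (1 : Matrix ι ι ℂ) ⊗ₖ σ, (e, 0), ?_, ?_, ?_⟩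
    · intro m hm l hl
      rcases Nat.lt_succ_iff_lt_or_eq.mp hm with hm | rfl <;>
        rcases Nat.lt_succ_iff_lt_or_eq.mp hl with hl | rfl
      · simp only [hm, hl, if_true, ← mul_kronecker_mul, hZZ]
        rw [← add_kronecker, hb.anti m hm l hl, zero_kronecker]
      · simp only [hm, lt_irrefl, if_true, if_false, ← mul_kronecker_mul, hZσ, hσZ, mul_one,
          one_mul]
        rw [← kronecker_add, add_neg_cancel, kronecker_zero]
      · simp only [hl, lt_irrefl, if_true, if_false, ← mul_kronecker_mul, hZσ, hσZ, mul_one,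
          one_mul]
        rw [← kronecker_add, neg_add_cancel, kronecker_zero]
      · simp only [lt_irrefl, if_false, ← mul_kronecker_mul, hσσ, kronecker_zero, add_zero]
    · intro m hm l hl
      rcases Nat.lt_succ_iff_lt_or_eq.mp hm with hm | rfl <;>
        rcases Nat.lt_succ_iff_lt_or_eq.mp hl with hl | rfl
      · simp only [hm, hl, if_true, conjTranspose_kronecker, ← mul_kronecker_mul, hZ, hZZ]
        rw [← add_kronecker, hb.anti_star m hm l hl]
        split_ifs
        · rw [one_kronecker_one]
        · rw [zero_kronecker]
      · simp only [hm, lt_irrefl, if_true, if_false, conjTranspose_kronecker, ← mul_kronecker_mul,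
          conjTranspose_one, hZσ', hσZ', mul_one, one_mul, hm.ne]
        rw [← kronecker_add, neg_add_cancel, kronecker_zero]
      · simp only [hl, lt_irrefl, if_true, if_false, conjTranspose_kronecker, ← mul_kronecker_mul,
          hZ, hZσ, hσZ, mul_one, one_mul, hl.ne']
        rw [← kronecker_add, neg_add_cancel, kronecker_zero]
      · simp only [lt_irrefl, if_false, if_true, conjTranspose_kronecker, ← mul_kronecker_mul,
          conjTranspose_one, mul_one]
        rw [← kronecker_add, hσσ', one_kronecker_one]
    · intro m hm x
      rcases Nat.lt_succ_iff_lt_or_eq.mp hm with hm | rfl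
      · simp [hm, hb.vacuum m hm]
      · obtain ⟨x, i⟩ := x
        fin_cases i <;> simp [σ]

lemma exists_isFock_fin (N : ℕ) : ∃ (D : ℕ) (b : ℕ → Matrix (Fin D) (Fin D) ℂ) (e : Fin D),
    IsFock N b e := by
  obtain ⟨ι, _, _, b, e, hb⟩ := exists_isFock N
  let f : Fin (Fintype.card ι) ≃ ι := (Fintype.equivFin ι).symm
  refine ⟨Fintype.card ι, fun m => (b m).submatrix f f, f.symm e, fun m hm l hl => ?_,
    fun m hm l hl => ?_, fun m hm x => ?_⟩
  · rw [submatrix_mul_equiv, submatrix_mul_equiv]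
    exact congrArg (fun M => M.submatrix f f) (hb.anti m hm l hl)
  · rw [conjTranspose_submatrix, submatrix_mul_equiv, submatrix_mul_equiv]
    refine (congrArg (fun M => M.submatrix f f) (hb.anti_star m hm l hl)).trans ?_
    split_ifs
    · exact submatrix_one_equiv f
    · rfl
  · simpa using hb.vacuum m hm (f x)

section Fock

variable {ι : Type*} [Fintype ι] [DecidableEq ι] {N : ℕ} {b : ℕ → Matrix ι ι ℂ} {e : ι}

/-- The annihilation operator `∑ₘ f(m) bₘ`, complex linear in `f`. -/
def annihilation (N : ℕ) (b : ℕ → Matrix ι ι ℂ) (f : ℕ → ℂ) : Matrix ι ι ℂ :=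
  ∑ m ∈ range N, f m • b m

/-- The self-adjoint field operator `∑ₘ (f(m) bₘ + h.c.)`. -/
def fieldOp (N : ℕ) (b : ℕ → Matrix ι ι ℂ) (f : ℕ → ℂ) : Matrix ι ι ℂ :=
  annihilation N b f + (annihilation N b f)ᴴ

lemma annihilation_anti (hb : IsFock N b e) (f g : ℕ → ℂ) :
    annihilation N b f * annihilation N b g + annihilation N b g * annihilation N b f = 0 := by
  simp only [annihilation, sum_mul_sum]
  rw [sum_comm (f := fun i j => g i • b i * f j • b j), ← sum_add_distrib]
  refine sum_eq_zero fun m hm => ?_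
  rw [← sum_add_distrib]
  refine sum_eq_zero fun l hl => ?_
  rw [smul_mul_smul_comm, smul_mul_smul_comm, mul_comm (g l), ← smul_add,
    hb.anti m (mem_range.mp hm) l (mem_range.mp hl), smul_zero]

lemma annihilation_anti_star (hb : IsFock N b e) (f g : ℕ → ℂ) :
    annihilation N b f * (annihilation N b g)ᴴ + (annihilation N b g)ᴴ * annihilation N b f =
      (∑ m ∈ range N, f m * star (g m)) • 1 := by
  simp only [annihilation, conjTranspose_sum, conjTranspose_smul, sum_mul_sum]
  rw [sum_comm (f := fun i j => star (g i) • (b i)ᴴ * f j • b j), ← sum_add_distrib, sum_smul]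
  refine sum_congr rfl fun m hm => ?_
  rw [← sum_add_distrib, sum_eq_single_of_mem m hm]
  · rw [smul_mul_smul_comm, smul_mul_smul_comm, mul_comm (star (g m)), ← smul_add,
      hb.anti_star m (mem_range.mp hm) m (mem_range.mp hm), if_pos rfl]
  · intro l hl hlm
    rw [smul_mul_smul_comm, smul_mul_smul_comm, mul_comm (star (g l)), ← smul_add,
      hb.anti_star m (mem_range.mp hm) l (mem_range.mp hl), if_neg hlm.symm, smul_zero]

lemma annihilation_vacuum (hb : IsFock N b e) (f : ℕ → ℂ) (x : ι) :
    annihilation N b f x e = 0 := by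
  rw [annihilation, Matrix.sum_apply]
  exact sum_eq_zero fun m hm => by simp [hb.vacuum m (mem_range.mp hm) x]

omit [Fintype ι] [DecidableEq ι] in
lemma fieldOp_isHermitian (f : ℕ → ℂ) : (fieldOp N b f)ᴴ = fieldOp N b f := by
  rw [fieldOp, conjTranspose_add, conjTranspose_conjTranspose, add_comm]

omit [Fintype ι] [DecidableEq ι] in
lemma fieldOp_neg (f : ℕ → ℂ) : fieldOp N b (fun m => -f m) = -fieldOp N b f := by
  simp [fieldOp, annihilation, add_comm]

lemma fieldOp_anti (hb : IsFock N b e) (f g : ℕ → ℂ) :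
    fieldOp N b f * fieldOp N b g + fieldOp N b g * fieldOp N b f =
      (∑ m ∈ range N, (f m * star (g m) + g m * star (f m))) • 1 := by
  have h1 := annihilation_anti hb f g
  have h2 : (annihilation N b f)ᴴ * (annihilation N b g)ᴴ +
      (annihilation N b g)ᴴ * (annihilation N b f)ᴴ = 0 := by
    have := congrArg conjTranspose (annihilation_anti hb g f)
    simpa [conjTranspose_mul] using this
  rw [sum_add_distrib, add_smul, ← annihilation_anti_star hb f g, ← annihilation_anti_star hb g f]
  simp only [fieldOp, mul_add, add_mul]
  generalize annihilation N b f = x at *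
  generalize annihilation N b g = y at *
  rw [← sub_eq_zero]
  calc _ = (x * y + y * x) + (xᴴ * yᴴ + yᴴ * xᴴ) := by abel
    _ = 0 := by rw [h1, h2, add_zero]

lemma fieldOp_mul_fieldOp_vacuum (hb : IsFock N b e) (f g : ℕ → ℂ) :
    (fieldOp N b f * fieldOp N b g) e e = ∑ m ∈ range N, f m * star (g m) := by
  have hcol : ∀ (M : Matrix ι ι ℂ) (h : ℕ → ℂ), (M * annihilation N b h) e e = 0 := by
    intro M h
    rw [Matrix.mul_apply]
    exact sum_eq_zero fun x _ => by rw [annihilation_vacuum hb, mul_zero]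
  have hrow : ∀ (M : Matrix ι ι ℂ) (h : ℕ → ℂ), ((annihilation N b h)ᴴ * M) e e = 0 := by
    intro M h
    rw [Matrix.mul_apply]
    exact sum_eq_zero fun x _ => by
      rw [conjTranspose_apply, annihilation_vacuum hb, star_zero, zero_mul]
  have h := congrFun (congrFun (annihilation_anti_star hb f g) e) e
  rw [Matrix.add_apply, hcol, add_zero] at h
  rw [fieldOp, fieldOp, add_mul, mul_add, Matrix.add_apply, Matrix.add_apply, hcol, hrow, h]
  simp

end Fock

section Ring

variable {R : Type*} [Ring R] [StarRing R] [Algebra ℂ R] [StarModule ℂ R]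

/-- The sign in `c_j c_l = ± c_l c_j` for `j, l ≤ n` and Majorana operators with `c_n = -c_0`.
In this range `j + n = l` means `j = 0` and `l = n`. -/
def exchangeSign (n j l : ℕ) : ℂ := if j = l ∨ j + n = l ∨ l + n = j then 1 else -1

omit [StarRing R] [StarModule ℂ R] in
lemma mul_mul_swap {p q r s : R} {α β γ δ : ℂ} (h1 : p * r = α • (r * p)) (h2 : p * s = β • (s * p))
    (h3 : q * r = γ • (r * q)) (h4 : q * s = δ • (s * q)) :
    p * q * (r * s) = (α * β * γ * δ) • (r * s * (p * q)) := by
  calc p * q * (r * s) = p * (q * r) * s := by simp only [mul_assoc]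
    _ = γ • (p * r * (q * s)) := by rw [h3]; simp only [mul_smul_comm, smul_mul_assoc, mul_assoc]
    _ = (γ * (α * δ)) • (r * (p * s) * q) := by
      rw [h1, h4]; simp only [mul_smul_comm, smul_mul_assoc, mul_assoc, smul_smul, mul_comm δ α]
    _ = (α * β * γ * δ) • (r * s * (p * q)) := by
      rw [h2]; simp only [mul_smul_comm, smul_mul_assoc, mul_assoc, smul_smul]
      congr 1; ring

/-- The operators `i c_v c_{v+1}` anti-commute exactly when they share one Majorana operator; the
antiperiodic closing `c_n = -c_0` turns the path into a cycle. -/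
lemma isCyclic_of_majorana {n : ℕ} (hn : 3 ≤ n) {c : ℕ → R} (hstar : ∀ j, star (c j) = c j)
    (hsq : ∀ j ≤ n, c j * c j = 1) (hanti : ∀ j < n, ∀ l < n, j ≠ l → c j * c l = -(c l * c j))
    (hn0 : c n = -c 0) : IsCyclic (fun v : Fin n => I • (c v * c (v + 1))) := by
  have hsign : ∀ j ≤ n, ∀ l ≤ n, c j * c l = exchangeSign n j l • (c l * c j) := by
    intro j hj l hl
    rw [exchangeSign]
    split_ifs with h
    · rcases h with rfl | h | h
      · simp
      · obtain ⟨rfl, rfl⟩ : j = 0 ∧ l = n := by omega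
        simp [hn0]
      · obtain ⟨rfl, rfl⟩ : l = 0 ∧ j = n := by omega
        simp [hn0]
    · rcases hj.lt_or_eq with hj | rfl <;> rcases hl.lt_or_eq with hl | rfl
      · rw [hanti j hj l hl (by omega)]; simp
      · rw [hn0, mul_neg, hanti j hj 0 (by omega) (by omega)]; simp
      · rw [hn0, neg_mul, hanti 0 (by omega) l hl (by omega)]; simp
      · omega
  have hswap : ∀ v w : Fin n, I • (c v * c (v + 1)) * I • (c w * c (w + 1)) =
      (exchangeSign n v w * exchangeSign n v (w + 1) * exchangeSign n (v + 1) w *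
        exchangeSign n (v + 1) (w + 1)) • (I • (c w * c (w + 1)) * I • (c v * c (v + 1))) := by
    intro v w
    rw [smul_mul_smul_comm, smul_mul_smul_comm, smul_comm _ (I * I),
      mul_mul_swap (hsign v (by omega) w (by omega)) (hsign v (by omega) (w + 1) (by omega))
        (hsign (v + 1) (by omega) w (by omega)) (hsign (v + 1) (by omega) (w + 1) (by omega))]
  have hsucc : ∀ v : Fin n, c (v + 1) * c v = -(c v * c (v + 1)) := by
    intro v
    rw [hsign (v + 1) (by omega) v (by omega), exchangeSign, if_neg (by omega)]
    simp
  refine ⟨fun v => ?_, fun v => ?_, fun v w h => ?_, fun v w h => ?_⟩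
  · rw [star_smul, star_mul, hstar, hstar, hsucc]
    simp
  · have h1 := hsq v (by omega)
    have h2 := hsq (v + 1) (by omega)
    rw [smul_mul_smul_comm, I_mul_I, mul_assoc, ← mul_assoc (c (v + 1)), hsucc, neg_mul, mul_assoc,
      h2, mul_one, mul_neg, h1]
    simp
  · rw [hswap v w]
    rw [cycleGraph_adj_val hn] at h
    have hs : exchangeSign n v w * exchangeSign n v (w + 1) * exchangeSign n (v + 1) w *
        exchangeSign n (v + 1) (w + 1) = -1 := by
      unfold exchangeSign
      split_ifs <;> first | omega | norm_num
    rw [hs, neg_one_smul]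
  · rw [hswap v w]
    rw [cycleGraph_adj_val hn] at h
    have hs : exchangeSign n v w * exchangeSign n v (w + 1) * exchangeSign n (v + 1) w *
        exchangeSign n (v + 1) (w + 1) = 1 := by
      unfold exchangeSign
      split_ifs <;> first | omega | norm_num
    rw [hs, one_smul]

end Ring

/-- `exp (i k)` or `exp (-i k)` for the antiperiodic momentum `k = angle n π m`, whichever has
non-negative imaginary part. -/
def bandPhase (n m : ℕ) : ℂ :=
  if 0 ≤ Real.sin (angle n Real.pi m) then phase n Real.pi m else star (phase n Real.pi m)

lemma bandPhase_mul_conj (n m : ℕ) : bandPhase n m * star (bandPhase n m) = 1 := by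
  rw [bandPhase]
  split_ifs
  · exact phase_mul_conj ..
  · rw [star_star]; exact conj_mul_phase ..

/-- A realisation of `Cₙ` with a state giving all observables the expectation `bandSum n π / n`.
Choosing `bandPhase` for each mode makes the vacuum the top eigenstate of `∑ B v`. -/
lemma exists_isCyclic_state {n : ℕ} (hn : 3 ≤ n) : ∃ (D : ℕ) (B : Fin n → Matrix (Fin D) (Fin D) ℂ)
    (e : Fin D), IsCyclic B ∧ ∀ v, B v e e = ((bandSum n Real.pi / n : ℝ) : ℂ) := by
  obtain ⟨D, b, e, hb⟩ := exists_isFock_fin n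
  have hn0 : (n : ℝ) ≠ 0 := by positivity
  set r : ℂ := (((√(n : ℝ))⁻¹ : ℝ) : ℂ) with hr
  have hrr : r * r = (n : ℂ)⁻¹ := by
    rw [hr, ← ofReal_mul, ← mul_inv, Real.mul_self_sqrt (by positivity)]; simp
  have hrs : star r = r := conj_ofReal _
  let f : ℕ → ℕ → ℂ := fun j m => r * bandPhase n m ^ j
  have hf : ∀ j l m, f j m * star (f l m) =
      (n : ℂ)⁻¹ * (bandPhase n m ^ j * star (bandPhase n m) ^ l) := by
    intro j l m
    simp only [f, star_mul, star_pow, hrs]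
    rw [← hrr]; ring
  have hsum : ∀ j < n, ∀ l < n, ∑ m ∈ range n, (f j m * star (f l m) + f l m * star (f j m)) =
      if j = l then 2 else 0 := by
    intro j hj l hl
    -- Conjugating a phase swaps the two summands, so the choice in `bandPhase` does not matter here.
    have hterm : ∀ m, f j m * star (f l m) + f l m * star (f j m) = (n : ℂ)⁻¹ *
        (phase n Real.pi m ^ j * star (phase n Real.pi m) ^ l +
          phase n Real.pi m ^ l * star (phase n Real.pi m) ^ j) := by
      intro m
      rw [hf, hf, ← mul_add, bandPhase]
      split_ifs
      · rfl
      · rw [star_star]; ring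
    simp only [hterm]
    rw [← mul_sum, sum_add_distrib, sum_phase_pow_mul_conj hj hl, sum_phase_pow_mul_conj hl hj]
    have : (n : ℂ) ≠ 0 := by exact_mod_cast hn0
    by_cases h : j = l
    · simp only [h, if_true]; field_simp; norm_num
    · simp [h, Ne.symm h]
  let c : ℕ → Matrix (Fin D) (Fin D) ℂ := fun j => fieldOp n b (f j)
  have hcn : c n = -c 0 := by
    rw [← fieldOp_neg]
    refine congrArg (fieldOp n b) (funext fun m => ?_)
    have : bandPhase n m ^ n = -1 := by
      rw [bandPhase]
      split_ifs
      · rw [phase_pow_self (by omega), exp_pi_mul_I]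
      · rw [← star_pow, phase_pow_self (by omega), exp_pi_mul_I]; simp
    simp [f, this]
  have hanti : ∀ j < n, ∀ l < n, c j * c l + c l * c j = (if j = l then (2 : ℂ) else 0) • 1 := by
    intro j hj l hl
    rw [fieldOp_anti hb, hsum j hj l hl]
  have hsq : ∀ j < n, c j * c j = 1 := by
    intro j hj
    have := hanti j hj j hj
    rw [if_pos rfl, ← two_smul ℂ] at this
    exact smul_right_injective _ (two_ne_zero' ℂ) this
  refine ⟨D, fun v => I • (c v * c (v + 1)), e, isCyclic_of_majorana hn
    (fun j => fieldOp_isHermitian _) ?_ ?_ hcn, ?_⟩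
  · intro j hj
    rcases hj.lt_or_eq with hj | rfl
    · exact hsq j hj
    · rw [hcn, neg_mul_neg, hsq 0 (by omega)]
  · intro j hj l hl hjl
    have := hanti j hj l hl
    rw [if_neg hjl, zero_smul] at this
    exact eq_neg_of_add_eq_zero_left this
  · intro v
    change (I • (c v * c (v + 1))) e e = _
    rw [Matrix.smul_apply, fieldOp_mul_fieldOp_vacuum hb]
    -- Each mode contributes the conjugate phase; the cosines add up to zero.
    have hterm : ∀ m, f v m * star (f (v + 1) m) = (n : ℂ)⁻¹ *
        ((Real.cos (angle n Real.pi m) : ℂ) - |Real.sin (angle n Real.pi m)| * I) := by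
      intro m
      rw [hf, pow_succ, ← mul_assoc (bandPhase n m ^ (v : ℕ)), ← mul_pow, bandPhase_mul_conj,
        one_pow, one_mul, bandPhase]
      congr 1
      split_ifs with h
      · apply Complex.ext <;> simp [-ofReal_cos, -ofReal_sin, phase_re, phase_im, abs_of_nonneg h]
      · rw [star_star]
        apply Complex.ext <;> simp [-ofReal_cos, -ofReal_sin, phase_re, phase_im,
          abs_of_neg (not_le.mp h)]
    simp only [hterm]
    rw [← mul_sum, sum_sub_distrib, ← sum_mul, ← ofReal_sum, ← ofReal_sum,
      sum_cos_angle (by omega)]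
    change I • ((n : ℂ)⁻¹ * ((0 : ℝ) - (bandSum n Real.pi : ℂ) * I)) = _
    rw [smul_eq_mul]
    push_cast
    linear_combination (-(n : ℂ)⁻¹ * bandSum n Real.pi) * I_mul_I

/-! ### Joint measurement of commuting involutions -/

section Joint

variable {V : Type*} [Fintype V] [DecidableEq V]

lemma sum_intUnits {M : Type*} [AddCommMonoid M] (f : ℤˣ → M) : ∑ s, f s = f 1 + f (-1) := by
  rw [UnitsInt.univ, sum_pair (by decide)]

lemma sum_filter_prod_eq {S : Type*} [CommRing S] (p : V → ℤˣ → S) (hp : ∀ v, ∑ s, p v s = 1)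
    (v : V) (s : ℤˣ) : ∑ a : V → ℤˣ with a v = s, ∏ w, p w (a w) = p v s := by
  have h1 : ({a : V → ℤˣ | a v = s} : Finset (V → ℤˣ)) =
      Fintype.piFinset (fun w => if w = v then {s} else univ) := by
    ext a
    simp only [mem_filter, mem_univ, true_and, Fintype.mem_piFinset]
    refine ⟨fun h w => ?_, fun h => by simpa using h v⟩
    split_ifs with hw
    · subst hw; simpa using h
    · exact mem_univ _
  rw [h1, ← prod_univ_sum, ← mul_prod_erase _ _ (mem_univ v), if_pos rfl, sum_singleton,
    prod_eq_one, mul_one]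
  intro w hw
  rw [if_neg (ne_of_mem_erase hw), hp]

open scoped IsMulCommutative in
/-- Commuting self-adjoint involutions are measured jointly by the products of their spectral
projections, formed in the commutative star subalgebra they generate. -/
lemma exists_joint_povm {ι : Type*} [Fintype ι] [DecidableEq ι] {C : V → Matrix ι ι ℂ}
    (hherm : ∀ v, star (C v) = C v) (hsq : ∀ v, C v * C v = 1)
    (hcomm : ∀ v w, C v * C w = C w * C v) :
    ∃ P : (V → ℤˣ) → Matrix ι ι ℂ, (∀ a, (P a).PosSemidef) ∧ ∑ a, P a = 1 ∧
      ∀ v s, ∑ a : V → ℤˣ with a v = s, P a = (1 / 2 : ℂ) • (1 + ((s : ℤ) : ℂ) • C v) := by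
  let S := StarAlgebra.adjoin ℂ (Set.range C)
  have : IsMulCommutative S := StarAlgebra.isMulCommutative_adjoin ℂ
    (by rintro _ ⟨v, rfl⟩ _ ⟨w, rfl⟩; exact hcomm v w)
    (by rintro _ ⟨v, rfl⟩ _ ⟨w, rfl⟩; rw [hherm]; exact hcomm v w)
  let c : V → S := fun v => ⟨C v, StarAlgebra.subset_adjoin ℂ _ ⟨v, rfl⟩⟩
  have hcc : ∀ v, c v * c v = 1 := fun v => Subtype.ext (hsq v)
  let p : V → ℤˣ → S := fun v s => (1 / 2 : ℂ) • (1 + ((s : ℤ) : ℂ) • c v)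
  have hps : ∀ v s, star (p v s) = p v s := by
    intro v s
    apply Subtype.ext
    simp [p, c, hherm, star_smul]
  have hpp : ∀ v s, p v s * p v s = p v s := by
    intro v s
    have h2 : (((s : ℤ) : ℂ)) * ((s : ℤ) : ℂ) = 1 := by
      rcases Int.units_eq_one_or s with rfl | rfl <;> simp
    have e : p v s * p v s = (1 / 4 : ℂ) • (1 + ((s : ℤ) : ℂ) • c v + ((s : ℤ) : ℂ) • c v +
        (((s : ℤ) : ℂ) * ((s : ℤ) : ℂ)) • (c v * c v)) := by
      apply Subtype.ext
      simp only [p]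
      change ((1 / 2 : ℂ) • (1 + ((s : ℤ) : ℂ) • C v)) * ((1 / 2 : ℂ) • (1 + ((s : ℤ) : ℂ) • C v)) =
        (1 / 4 : ℂ) • (1 + ((s : ℤ) : ℂ) • C v + ((s : ℤ) : ℂ) • C v +
        (((s : ℤ) : ℂ) * ((s : ℤ) : ℂ)) • (C v * C v))
      simp only [mul_add, add_mul, mul_one, one_mul, smul_add, smul_smul, mul_smul_comm,
        smul_mul_assoc]
      module
    rw [e, h2, hcc]
    module
  have hsum : ∀ v, ∑ s, p v s = 1 := by
    intro v
    rw [sum_intUnits]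
    simp only [p]
    push_cast
    module
  refine ⟨fun a => ((∏ v, p v (a v) : S) : Matrix ι ι ℂ), fun a => ?_, ?_, fun v s => ?_⟩
  · have h1 : (∏ v, p v (a v) : S) = star (∏ v, p v (a v)) * ∏ v, p v (a v) := by
      rw [star_prod, ← prod_mul_distrib]
      exact prod_congr rfl fun v _ => by rw [hps, hpp]
    dsimp only
    rw [h1]
    exact posSemidef_conjTranspose_mul_self _
  · have h := prod_univ_sum (fun _ : V => (univ : Finset ℤˣ)) p
    rw [prod_congr rfl fun v _ => hsum v, prod_const_one, Fintype.piFinset_univ] at h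
    have h' := congrArg (Subtype.val : S → Matrix ι ι ℂ) h
    rw [AddSubmonoidClass.coe_finsetSum] at h'
    exact h'.symm
  · have h' := congrArg (Subtype.val : S → Matrix ι ι ℂ) (sum_filter_prod_eq p hsum v s)
    rw [AddSubmonoidClass.coe_finsetSum] at h'
    exact h'

end Joint

/-! ### Robustness of the cycle -/

section Robustness

variable {n d : ℕ} {A : Fin n → Matrix (Fin d) (Fin d) ℂ}

lemma exists_adj {n : ℕ} (hn : 3 ≤ n) (v : Fin n) : ∃ w, (SimpleGraph.cycleGraph n).Adj v w :=
  ⟨wrap hn (v + 1), by simpa [wrap_val] using adj_wrap_succ hn v⟩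

/-- Each observable anti-commutes with an invertible one, hence is traceless, so the noise term of
`noisy` vanishes. -/
lemma IsCyclic.trace_eq_zero (hn : 3 ≤ n) (hA : IsCyclic A) (v : Fin n) : (A v).trace = 0 := by
  obtain ⟨w, h⟩ := exists_adj hn v
  have h1 : A v = -(A w * A v * A w) := by
    rw [← neg_mul, ← hA.anti v w h, mul_assoc, hA.mul_self, mul_one]
  have h2 := congrArg trace h1
  rw [trace_neg, trace_mul_comm, ← mul_assoc, hA.mul_self, one_mul] at h2
  exact self_eq_neg.mp h2

lemma noisy_of_trace_eq_zero {B : Matrix (Fin d) (Fin d) ℂ} (hB : B.trace = 0) (η : ℝ) :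
    noisy η B = (η : ℂ) • B := by
  simp [noisy, hB]

lemma IsCyclic.realises (hd : 0 < d) (hA : IsCyclic A) :
    Realises A (SimpleGraph.cycleGraph n) where
  isHermitian v := hA.star_eq v
  sq_eq_one v := by rw [sq, hA.mul_self]
  adj_iff v w := by
    refine ⟨hA.anti v w, fun h => ?_⟩
    by_contra hvw
    have h2 : (2 : ℂ) • (A v * A w) = 0 := by
      rw [two_smul]
      nth_rewrite 1 [h]
      rw [← hA.comm v w hvw, neg_add_cancel]
    have h0 : A v * A w = 0 := (smul_eq_zero.mp h2).resolve_left two_ne_zero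
    have h1 : (1 : Matrix (Fin d) (Fin d) ℂ) = 0 := by
      calc (1 : Matrix (Fin d) (Fin d) ℂ) = A v * (A v * A w) * A w := by
            rw [← mul_assoc, hA.mul_self, one_mul, hA.mul_self]
        _ = 0 := by rw [h0, mul_zero, zero_mul]
    have := congrFun (congrFun h1 ⟨0, hd⟩) ⟨0, hd⟩
    simp at this
  commute_of_not_adj := hA.comm

lemma IsCyclic.signed (hA : IsCyclic A) (a : Fin n → ℤˣ) :
    IsCyclic (fun v => ((a v : ℤ) : ℂ) • A v) where
  star_eq v := by rw [star_smul, hA.star_eq]; simp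
  mul_self v := by
    rw [smul_mul_smul_comm, hA.mul_self]
    rcases Int.units_eq_one_or (a v) with h | h <;> simp [h]
  anti v w h := by
    rw [smul_mul_smul_comm, smul_mul_smul_comm, hA.anti v w h, smul_neg, mul_comm]
  comm v w h := by
    rw [smul_mul_smul_comm, smul_mul_smul_comm, hA.comm v w h, mul_comm]

lemma trace_mul_nonneg {P Q : Matrix (Fin d) (Fin d) ℂ} (hP : P.PosSemidef)
    (hQ : Q.PosSemidef) : 0 ≤ (P * Q).trace := by
  obtain ⟨B, rfl⟩ : ∃ B : Matrix (Fin d) (Fin d) ℂ, P = Bᴴ * B := by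
    open scoped MatrixOrder in
    exact CStarAlgebra.nonneg_iff_eq_star_mul_self.mp hP.nonneg
  rw [mul_assoc, trace_mul_comm]
  exact (hQ.mul_mul_conjTranspose_same B).trace_nonneg

/-- Pairing the parent measurement with the operators `∑ a_v A_v`, each at most `bandSum n π`. -/
lemma le_of_jointlyMeasurable (hn : 3 ≤ n) (hd : 0 < d) (hA : IsCyclic A) {η : ℝ}
    (h : JointlyMeasurable fun v => effect (noisy η (A v))) : η ≤ bandSum n Real.pi / n := by
  obtain ⟨E, hE, hmarg⟩ := h
  replace hmarg : ∀ v s, ∑ a : Fin n → ℤˣ with a v = s, E a = effect (noisy η (A v)) s := hmarg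
  have hobs : ∀ v, ∑ a, ((a v : ℤ) : ℂ) • E a = (η : ℂ) • A v := by
    intro v
    rw [← sum_fiberwise univ (fun a : Fin n → ℤˣ => a v)]
    have : ∀ s : ℤˣ, ∑ a : Fin n → ℤˣ with a v = s, ((a v : ℤ) : ℂ) • E a =
        ((s : ℤ) : ℂ) • effect (noisy η (A v)) s := by
      intro s
      rw [← hmarg v s, smul_sum]
      exact sum_congr rfl fun a ha => by rw [(mem_filter.mp ha).2]
    rw [sum_congr rfl fun s _ => this s, sum_intUnits,
      noisy_of_trace_eq_zero (hA.trace_eq_zero hn v)]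
    simp only [effect]
    push_cast
    module
  have hpos : ∀ a, 0 ≤ (E a * ((bandSum n Real.pi : ℂ) • (1 : Matrix (Fin d) (Fin d) ℂ) -
      ∑ v, ((a v : ℤ) : ℂ) • A v)).trace := fun a =>
    trace_mul_nonneg (hE.posSemidef a) (posSemidef_sub_sum hn (hA.signed a))
  have htot := sum_nonneg fun a (_ : a ∈ (univ : Finset (Fin n → ℤˣ))) => hpos a
  have heq : ∑ a, (E a * ((bandSum n Real.pi : ℂ) • (1 : Matrix (Fin d) (Fin d) ℂ) -
      ∑ v, ((a v : ℤ) : ℂ) • A v)).trace = ((bandSum n Real.pi - n * η) * d : ℝ) := by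
    rw [← trace_sum]
    simp only [mul_sub, sum_sub_distrib, mul_smul_comm, mul_one, mul_sum]
    rw [← smul_sum, hE.sum_eq_one, sum_comm]
    have : ∀ v, ∑ a, ((a v : ℤ) : ℂ) • (E a * A v) = (η : ℂ) • 1 := by
      intro v
      simp only [← smul_mul_assoc]
      rw [← sum_mul, hobs, smul_mul_assoc, hA.mul_self]
    simp only [this, sum_const, card_univ, Fintype.card_fin, ← Nat.cast_smul_eq_nsmul ℂ, trace_sub,
      trace_smul, trace_one, smul_eq_mul]
    push_cast
    ring
  rw [heq, zero_le_real] at htot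
  have hd' : (0 : ℝ) < d := by exact_mod_cast hd
  have hn' : (0 : ℝ) < n := by positivity
  rw [le_div_iff₀ hn']
  have := nonneg_of_mul_nonneg_left htot hd'
  linarith

/-- Joint spectral projections of the commuting operators `A v ⊗ B v`, compressed to `ℂ^d ⊗ e`, form
a parent measurement for the observables `⟨e, B v e⟩ A v`. -/
lemma jointlyMeasurable_of_state {D : ℕ} {B : Fin n → Matrix (Fin D) (Fin D) ℂ} (hn : 3 ≤ n)
    (hA : IsCyclic A) (hB : IsCyclic B) {e : Fin D} {η : ℝ} (he : ∀ v, B v e e = η) :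
    JointlyMeasurable fun v => effect (noisy η (A v)) := by
  have hcomm : ∀ v w, (A v ⊗ₖ B v) * (A w ⊗ₖ B w) = (A w ⊗ₖ B w) * (A v ⊗ₖ B v) := by
    intro v w
    rw [← mul_kronecker_mul, ← mul_kronecker_mul]
    by_cases h : (SimpleGraph.cycleGraph n).Adj v w
    · rw [hA.anti v w h, hB.anti v w h]
      ext i j
      simp
    · rw [hA.comm v w h, hB.comm v w h]
  obtain ⟨P, hP, hsum, hmarg⟩ := exists_joint_povm (C := fun v => A v ⊗ₖ B v)
    (fun v => by
      rw [star_eq_conjTranspose, conjTranspose_kronecker, ← star_eq_conjTranspose, hA.star_eq,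
        ← star_eq_conjTranspose, hB.star_eq])
    (fun v => by rw [← mul_kronecker_mul, hA.mul_self, hB.mul_self, one_kronecker_one]) hcomm
  let g : Fin d → Fin d × Fin D := fun i => (i, e)
  have hg : ∀ s : Finset (Fin n → ℤˣ), ∑ a ∈ s, (P a).submatrix g g =
      (∑ a ∈ s, P a).submatrix g g := by
    intro s
    ext i j
    simp [Matrix.sum_apply]
  refine ⟨fun a => (P a).submatrix g g, ⟨fun a => (hP a).submatrix g, ?_⟩, fun v s => ?_⟩
  · rw [hg, hsum]
    exact submatrix_one g fun i j h => congrArg Prod.fst h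
  · rw [hg, hmarg]
    change _ = effect (noisy η (A v)) s
    rw [effect, noisy_of_trace_eq_zero (hA.trace_eq_zero hn v)]
    ext i j
    simp only [submatrix_apply, Matrix.smul_apply, Matrix.add_apply, kroneckerMap_apply, g, he,
      one_apply, Prod.mk.injEq, and_true, smul_eq_mul]
    ring

lemma isGreatest_visibilities (hn : 3 ≤ n) (hd : 0 < d) (hA : IsCyclic A) :
    IsGreatest (visibilities A) (bandSum n Real.pi / n) := by
  obtain ⟨D, B, e, hB, he⟩ := exists_isCyclic_state hn
  exact ⟨⟨⟨div_nonneg (bandSum_nonneg _ _) (by positivity), bandSum_div_le_one (by omega) _⟩,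
    jointlyMeasurable_of_state hn hA hB he⟩, fun η hη => le_of_jointlyMeasurable hn hd hA hη.2⟩

lemma exists_realises_cycleGraph (hn : 3 ≤ n) : ∃ d : ℕ, 0 < d ∧
    ∃ A : Fin n → Matrix (Fin d) (Fin d) ℂ, Realises A (SimpleGraph.cycleGraph n) := by
  obtain ⟨D, B, e, hB, -⟩ := exists_isCyclic_state hn
  exact ⟨D, e.pos, B, hB.realises e.pos⟩

lemma eta_cycleGraph (hn : 3 ≤ n) :
    eta (SimpleGraph.cycleGraph n) = bandSum n Real.pi / n := by
  obtain ⟨d, hd, A, hA⟩ := exists_realises_cycleGraph hn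
  refine IsGreatest.csSup_eq ⟨⟨d, hd, A, hA, (isGreatest_visibilities hn hd hA.isCyclic).1⟩, ?_⟩
  rintro η ⟨d, hd, A, hA, hη⟩
  exact (isGreatest_visibilities hn hd hA.isCyclic).2 hη

end Robustness

end IncompatibilityRobustness

end

theorem mainTheorem7 :
    (∀ n : ℕ, 3 ≤ n →
      (∃ d : ℕ, 0 < d ∧ ∃ A : Fin n → Matrix (Fin d) (Fin d) ℂ,
        IncompatibilityRobustness.Realises A (SimpleGraph.cycleGraph n)) ∧
      (∀ d : ℕ, 0 < d → ∀ A : Fin n → Matrix (Fin d) (Fin d) ℂ,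
        IncompatibilityRobustness.Realises A (SimpleGraph.cycleGraph n) →
        IsGreatest (IncompatibilityRobustness.visibilities A)
          (IncompatibilityRobustness.eta (SimpleGraph.cycleGraph n))) ∧
      (Odd n → IncompatibilityRobustness.eta (SimpleGraph.cycleGraph n) =
        1 / (n : ℝ) * Real.cot (Real.pi / (2 * (n : ℝ)))) ∧
      (Even n → IncompatibilityRobustness.eta (SimpleGraph.cycleGraph n) =
        2 / (n : ℝ) * (1 / Real.sin (Real.pi / (n : ℝ))))) ∧
    Filter.Tendsto (fun n : ℕ => IncompatibilityRobustness.eta (SimpleGraph.cycleGraph n))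
      Filter.atTop (nhds (2 / Real.pi)) := by
  open IncompatibilityRobustness in
  refine ⟨fun n hn => ⟨exists_realises_cycleGraph hn, fun d hd A hA => ?_, fun h => ?_,
    fun h => ?_⟩, ?_⟩
  · rw [eta_cycleGraph hn]
    exact isGreatest_visibilities hn hd hA.isCyclic
  · rw [eta_cycleGraph hn, bandSum_div_of_odd (by omega) h]
  · rw [eta_cycleGraph hn, bandSum_div_of_even (by omega) h]
  · refine tendsto_bandSum_div.congr' ?_
    filter_upwards [Filter.eventually_ge_atTop 3] with n hn
    rw [eta_cycleGraph hn]
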